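/- Let $\varrho$ be a primitive substitution on $n$ letters with substitution matrix $M\in\mathrm{Mat}(n,\mathbb Z)$, where $M_{ij}$ is the number of letters $i$ in the word $\varrho(j)$. Assume that $\varrho$ is unimodular, $|\det M|=1$, and that its Perron--Frobenius eigenvalue $\lambda$ is a Pisot--Vijayaraghavan (PV) number, i.e. a real algebraic integer $>1$ all of whose other algebraic conjugates lie in the open unit disc. Consider the induced geometric inflation with inflation factor $\lambda$, where the length of the interval (prototile) of type $j$ is the $j$-th entry of a positive left eigenvector of $M$ for $\lambda$, and let $T_{ij}\subset\mathbb R$ be the finite set of positions, relative to the left endpoint, of the left endpoints of tiles of type $i$ in the supertile $\varrho(j)$ (the displacement matrix). Let a tiling of $\mathbb R$ by prototiles be a fixed point of this inflation, and let $\Lambda_i\subset\mathbb R$ be the set of left endpoints (control points) of its tiles of type $i$. Let $(\mathbb R,\mathbb R^m,\mathcal L)$ be a Euclidean cut-and-project scheme: $\mathcal L\subset\mathbb R\times\mathbb R^m$ is a lattice, the projection $\pi$ to $\mathbb R$ is injective on $\mathcal L$, and the projection of $\mathcal L$ to $\mathbb R^m$ is dense. Put $L=\pi(\mathcal L)$,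 let ${}^\star\colon L\to\mathbb R^m$ be the star map, so that $(x,x^\star)\in\mathcal L$ for $x\in L$, and write $\curlywedge(W)=\{x\in L: x^\star\in W\}$ for $W\subset\mathbb R^m$. Suppose that for $1\le i\le n$ the set $W_i\subset\mathbb R^m$ is relatively compact, with non-empty interior and with boundary of Lebesgue measure $0$, and that $\Lambda_i=\curlywedge(W_i)$ up to a set of zero density (in particular, equality is allowed); here $S\subset\mathbb R$ has zero density if $\mathrm{card}(S\cap[-r,r])/(2r)\to0$ as $r\to\infty$. Then $T_{ij}\subset L$ for all $i,j$, and there is a unique invertible linear map $\lambda^\star\colon\mathbb R^m\to\mathbb R^m$ such that $\lambda x\in L$ and $(\lambda x)^\star=\lambda^\star x^\star$ for all $x\in L$. Moreover, the functions $g_{\alpha\beta}:=\mathbf 1_{-W_\alpha}*\mathbf 1_{W_\beta}$ satisfy, for all $i,j$ and almost every $y\in\mathbb R^m$, $$g_{ij}(y)=\frac1\lambda\sum_{k,\ell=1}^n\ \sum_{r\in T_{ik}}\ \sum_{s\in T_{j\ell}} g_{k\ell}\bigl((\lambda^\star)^{-1}(y+r^\star-s^\star)\bigr).$$ -/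

import Mathlib

open scoped Pointwise

noncomputable section

/-! ### Substitutions and geometric inflations -/

/-- A substitution on the alphabet `Fin n`: each letter is sent to a non-empty finite word. -/
structure Substitution (n : ℕ) where
  word : Fin n → List (Fin n)
  word_ne_nil : ∀ j, word j ≠ []

namespace Substitution

variable {n : ℕ} (σ : Substitution n)

/-- The substitution matrix: the entry `(i, j)` is the number of letters `i` in the image
of the letter `j`. -/
def matrix : Matrix (Fin n) (Fin n) ℤ :=
  Matrix.of fun i j => ((σ.word j).count i : ℤ)

def Primitive : Prop := σ.matrix.IsPrimitive

def Unimodular : Prop := |σ.matrix.det| = 1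

end Substitution

/-- A geometric inflation rule in one dimension: a primitive substitution together with
positive prototile lengths that form a left eigenvector of the substitution matrix. By
Perron--Frobenius theory, the eigenvalue `factor` is then the leading one, and the length
vector is unique up to a positive multiple. -/
structure Inflation (n : ℕ) extends Substitution n where
  primitive : toSubstitution.Primitive
  factor : ℝ
  tileLength : Fin n → ℝ
  tileLength_pos : ∀ j, 0 < tileLength j
  eigenvector :
    Matrix.vecMul tileLength (toSubstitution.matrix.map (Int.cast : ℤ → ℝ)) =
      factor • tileLength

namespace Inflation

variable {n : ℕ} (ϱ : Inflation n)

/-- The displacement matrix: `ϱ.displacement i j` is the set of positions, relative to the left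
endpoint of the supertile, of (the left endpoints of) the tiles of type `i` in the supertile
of type `j`. The position of the `p`-th tile is the total length of the tiles before it. -/
def displacement (i j : Fin n) : Finset ℝ :=
  ((Finset.range (ϱ.word j).length).filter fun p => (ϱ.word j)[p]? = some i).image
    fun p => (((ϱ.word j).take p).map ϱ.tileLength).sum

/-- The geometric inflation, acting on sets of tiles; the pair `(x, i)` is the tile of type `i`
with left endpoint `x`. Each tile is stretched by the inflation factor and then dissected
according to the substitution. -/
def inflate (S : Set (ℝ × Fin n)) : Set (ℝ × Fin n) :=
  {q | ∃ p ∈ S, ∃ t ∈ ϱ.displacement q.2 p.2, q.1 = ϱ.factor * p.1 + t}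

/-- A tiling of the real line by prototiles: a bi-infinite word, and the left endpoints of the
consecutive tiles. -/
structure Tiling where
  letter : ℤ → Fin n
  pos : ℤ → ℝ
  pos_succ : ∀ k, pos (k + 1) = pos k + ϱ.tileLength (letter k)

namespace Tiling

variable {ϱ} (τ : ϱ.Tiling)

def tiles : Set (ℝ × Fin n) := Set.range fun k => (τ.pos k, τ.letter k)

def IsFixedPoint : Prop := ϱ.inflate τ.tiles = τ.tiles

/-- The control points of type `i`: the left endpoints of the tiles of type `i`. -/
def controlPoints (i : Fin n) : Set ℝ := {x | (x, i) ∈ τ.tiles}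

end Tiling

end Inflation

/-- Pisot--Vijayaraghavan numbers: real algebraic integers larger than `1` all of whose other
algebraic conjugates lie in the open unit disc. -/
def IsPVNumber (lam : ℝ) : Prop :=
  1 < lam ∧ IsIntegral ℤ lam ∧
    ∀ z : ℂ, Polynomial.aeval z (minpoly ℚ lam) = 0 → z ≠ (lam : ℂ) → ‖z‖ < 1

/-! ### Cut-and-project schemes and model sets -/

/-- A Euclidean cut-and-project scheme `(ℝ, ℝ^m, 𝓛)`. -/
structure EuclideanCPS (m : ℕ) where
  lattice : Submodule ℤ (ℝ × EuclideanSpace ℝ (Fin m))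
  discrete : DiscreteTopology lattice
  isZLattice : IsZLattice ℝ lattice
  fst_injOn : Set.InjOn Prod.fst (lattice : Set (ℝ × EuclideanSpace ℝ (Fin m)))
  dense_snd : Dense (Prod.snd '' (lattice : Set (ℝ × EuclideanSpace ℝ (Fin m))))

namespace EuclideanCPS

variable {m : ℕ} (P : EuclideanCPS m)

/-- The projection `L` of the lattice to physical space. -/
def L : Set ℝ := Prod.fst '' (P.lattice : Set (ℝ × EuclideanSpace ℝ (Fin m)))

lemma exists_of_mem_L {x : ℝ} (hx : x ∈ P.L) :
    ∃ y : EuclideanSpace ℝ (Fin m), (x, y) ∈ P.lattice := by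
  obtain ⟨⟨a, b⟩, h, rfl⟩ := hx
  exact ⟨b, h⟩

open Classical in
/-- The star map `L → ℝ^m`, extended by `0` to points outside `L`. -/
def star (x : ℝ) : EuclideanSpace ℝ (Fin m) :=
  if hx : x ∈ P.L then (P.exists_of_mem_L hx).choose else 0

lemma star_eq {x : ℝ} {y : EuclideanSpace ℝ (Fin m)} (h : (x, y) ∈ P.lattice) :
    P.star x = y := by
  have hx : x ∈ P.L := ⟨(x, y), h, rfl⟩
  have hs : P.star x = (P.exists_of_mem_L hx).choose := dif_pos hx
  rw [hs]
  exact congrArg Prod.snd (P.fst_injOn (P.exists_of_mem_L hx).choose_spec h rfl)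

/-- The cut-and-project set with window `W`. -/
def cutProject (W : Set (EuclideanSpace ℝ (Fin m))) : Set ℝ :=
  {x | x ∈ P.L ∧ P.star x ∈ W}

/-- `A` is the linear map `λ^⋆` on internal space: multiplication by `lam` preserves `L`, and
the star map intertwines it with `A`. -/
def IsStarDilation (lam : ℝ)
    (A : EuclideanSpace ℝ (Fin m) ≃L[ℝ] EuclideanSpace ℝ (Fin m)) : Prop :=
  ∀ x ∈ P.L, lam * x ∈ P.L ∧ P.star (lam * x) = A (P.star x)

end EuclideanCPS

/-- Windows of regular model sets: relatively compact, with non-empty interior and with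
boundary of Lebesgue measure `0`. -/
def IsRegularWindow {m : ℕ} (W : Set (EuclideanSpace ℝ (Fin m))) : Prop :=
  IsCompact (closure W) ∧ (interior W).Nonempty ∧ MeasureTheory.volume (frontier W) = 0

/-- A set of reals has zero density if `card (S ∩ [-r, r]) / (2 r) → 0` as `r → ∞`. -/
def HasZeroDensity (S : Set ℝ) : Prop :=
  Filter.Tendsto
    (fun r : ℝ => ((S ∩ Set.Icc (-r) r).encard : ENNReal) / ENNReal.ofReal (2 * r))
    Filter.atTop (nhds 0)

/-- The cross covariogram `1_{-V} * 1_W`. -/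
def crossCovariogram {m : ℕ} (V W : Set (EuclideanSpace ℝ (Fin m))) :
    EuclideanSpace ℝ (Fin m) → ℝ :=
  MeasureTheory.convolution ((-V).indicator fun _ => (1 : ℝ)) (W.indicator fun _ => (1 : ℝ))
    (ContinuousLinearMap.mul ℝ ℝ) MeasureTheory.volume

end

/-! A set of zero density cannot exhaust a model set with non-empty open window, because such a
model set is relatively dense. Hence finitely many membership relations between `Λ_i` and `⋏(W_i)`
can be used as exact equalities at some point `x ∈ L` with `x^⋆` in any prescribed open set and `x`
as large as desired (`RelativelyDenseAtTop.exists_mem_notMem`).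

This forces `L` to be the ℤ-span of the tile lengths (`L_eq_lengthModule`). The eigenvector equation
and unimodularity make multiplication by `λ` a bijection of that span. Extending from a lattice
basis gives `(λx)^⋆ = x v + A x^⋆` on `L`; bounded windows and arbitrarily large `x` force `v = 0`,
and density of `L^⋆` makes `A` invertible and unique.

The fixed point equation partitions each `Λ_i` into the sets `λ Λ_k + r`. Since window boundaries
are null, this transfers to an almost everywhere identity for the `W_i`
(`ae_sum_indicator_window_eq`). Pairing its volumes with the left eigenvector gives `|det λ^⋆| =
1/λ`. Multiplying the identities for `W_i` at `t` and `W_j` at `t + y`, integrating, and changing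
variables gives the renormalisation equation. -/

noncomputable section

/-! ### Zero density sets and relative density at infinity -/

namespace HasZeroDensity

theorem mono {S T : Set ℝ} (hT : HasZeroDensity T) (hST : S ⊆ T) : HasZeroDensity S :=
  tendsto_of_tendsto_of_tendsto_of_le_of_le tendsto_const_nhds hT (fun _ => zero_le)
    fun _ => ENNReal.div_le_div_right
      (ENat.toENNReal_le.2 (Set.encard_le_encard (Set.inter_subset_inter_left _ hST))) _

theorem empty : HasZeroDensity ∅ := by
  simp [HasZeroDensity]

theorem union {S T : Set ℝ} (hS : HasZeroDensity S) (hT : HasZeroDensity T) :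
    HasZeroDensity (S ∪ T) := by
  have h := Filter.Tendsto.add hS hT
  rw [add_zero] at h
  refine tendsto_of_tendsto_of_tendsto_of_le_of_le tendsto_const_nhds h (fun _ => zero_le)
    fun r => ?_
  rw [← ENNReal.add_div, Set.union_inter_distrib_right, ← ENat.toENNReal_add]
  exact ENNReal.div_le_div_right (ENat.toENNReal_le.2 (Set.encard_union_le _ _)) _

theorem biUnion_finset {ι : Type*} (s : Finset ι) {f : ι → Set ℝ}
    (hf : ∀ i ∈ s, HasZeroDensity (f i)) : HasZeroDensity (⋃ i ∈ s, f i) := by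
  classical
  induction s using Finset.induction_on with
  | empty => simpa using empty
  | insert a s _ ih =>
    rw [Finset.set_biUnion_insert]
    exact (hf a (Finset.mem_insert_self a s)).union
      (ih fun i hi => hf i (Finset.mem_insert_of_mem hi))

theorem iUnion {ι : Type*} [Fintype ι] {f : ι → Set ℝ} (hf : ∀ i, HasZeroDensity (f i)) :
    HasZeroDensity (⋃ i, f i) := by
  simpa using biUnion_finset Finset.univ fun i _ => hf i

theorem preimage_affine {S : Set ℝ} (hS : HasZeroDensity S) {a : ℝ} (ha : a ≠ 0) (b : ℝ) :
    HasZeroDensity {y | a * y + b ∈ S} := by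
  -- With this `c`, the map `y ↦ a y + b` sends `[-r, r]` into `[-cr, cr]` as soon as `r ≥ |b|`.
  set c : ℝ := |a| + 1 with hc
  have hc0 : 0 < c := by positivity
  have h : Filter.Tendsto (fun r : ℝ => ENNReal.ofReal c *
      (((S ∩ Set.Icc (-(c * r)) (c * r)).encard : ENNReal) / ENNReal.ofReal (2 * (c * r))))
      Filter.atTop (nhds 0) := by
    have h1 := ENNReal.Tendsto.const_mul
      (hS.comp (Filter.tendsto_id.const_mul_atTop hc0)) (a := ENNReal.ofReal c)
      (Or.inr ENNReal.ofReal_ne_top)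
    simpa using h1
  refine tendsto_of_tendsto_of_tendsto_of_le_of_le' tendsto_const_nhds h
    (Filter.Eventually.of_forall fun _ => zero_le) ?_
  filter_upwards [Filter.eventually_ge_atTop |b|, Filter.eventually_gt_atTop 0] with r hr hr0
  have hcount : ({y | a * y + b ∈ S} ∩ Set.Icc (-r) r).encard ≤
      (S ∩ Set.Icc (-(c * r)) (c * r)).encard := by
    refine Set.encard_le_encard_of_injOn (f := fun y => a * y + b) ?_ ?_
    · rintro y ⟨hy, hyr⟩
      refine ⟨hy, abs_le.1 ?_⟩
      have h1 : |y| ≤ r := abs_le.2 hyr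
      calc |a * y + b| ≤ |a| * |y| + |b| := by
            rw [← abs_mul]
            exact abs_add_le _ _
        _ ≤ |a| * r + r := by gcongr
        _ = c * r := by rw [hc]; ring
    · intro x _ y _ hxy
      exact mul_left_cancel₀ ha (add_right_cancel hxy)
  have hscale : ENNReal.ofReal (2 * (c * r)) = ENNReal.ofReal c * ENNReal.ofReal (2 * r) := by
    rw [← ENNReal.ofReal_mul hc0.le]
    congr 1
    ring
  rw [hscale, ← mul_div_assoc, ENNReal.mul_div_mul_left _ _
    (by simpa using hc0) ENNReal.ofReal_ne_top]
  exact ENNReal.div_le_div_right (ENat.toENNReal_le.2 hcount) _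

end HasZeroDensity

/-- A set of reals is relatively dense at infinity if it meets all intervals of some fixed
length that lie sufficiently far to the right. -/
def RelativelyDenseAtTop (S : Set ℝ) : Prop :=
  ∃ C a₀ : ℝ, ∀ a ≥ a₀, ∃ x ∈ S, |x - a| ≤ C

theorem RelativelyDenseAtTop.not_hasZeroDensity {S : Set ℝ} (hS : RelativelyDenseAtTop S) :
    ¬ HasZeroDensity S := by
  intro hzero
  obtain ⟨C', a', h'⟩ := hS
  obtain ⟨C, a₀, hC, ha₀, h⟩ : ∃ C a₀ : ℝ, 0 < C ∧ 0 ≤ a₀ ∧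
      ∀ a ≥ a₀, ∃ x ∈ S, |x - a| ≤ C := by
    refine ⟨max C' 1, max a' 0, by positivity, le_max_right _ _, fun a ha => ?_⟩
    obtain ⟨x, hx, hxa⟩ := h' a (le_trans (le_max_left _ _) ha)
    exact ⟨x, hx, hxa.trans (le_max_left _ _)⟩
  -- Spacing `3C` exceeds the total error `2C`, so the chosen points are distinct.
  have hex : ∀ k : ℕ, ∃ x ∈ S, |x - (a₀ + 3 * C * k)| ≤ C := fun k =>
    h _ (le_add_of_nonneg_right (by positivity))
  choose x hxS hx using hex
  have hinj : Function.Injective x := by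
    intro k l hkl
    by_contra hne
    have h1 : (1 : ℝ) ≤ |(k : ℝ) - l| := by
      have : (1 : ℤ) ≤ |(k : ℤ) - l| := Int.one_le_abs (by omega)
      exact_mod_cast this
    have h2 : |3 * C * ((k : ℝ) - l)| ≤ C + C := by
      have e : 3 * C * ((k : ℝ) - l) =
          (x l - (a₀ + 3 * C * l)) - (x k - (a₀ + 3 * C * k)) := by rw [hkl]; ring
      rw [e]
      exact (abs_sub _ _).trans (add_le_add (hx l) (hx k))
    rw [abs_mul, abs_of_pos (by positivity : 0 < 3 * C)] at h2
    nlinarith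
  -- Once `a₀ ≤ CN`, the first `N` points lie in `[-4CN, 4CN]`, an interval of length `8CN`; this
  -- keeps the density at least `1/(8C)`.
  have hlim : Filter.Tendsto (fun N : ℕ => 4 * C * (N : ℝ)) Filter.atTop Filter.atTop :=
    tendsto_natCast_atTop_atTop.const_mul_atTop (by positivity)
  have hlt := (hzero.comp hlim).eventually
    (gt_mem_nhds (show (0 : ENNReal) < ENNReal.ofReal (1 / (8 * C)) by
      rw [ENNReal.ofReal_pos]; positivity))
  obtain ⟨N, hN, hN0, hNa⟩ := (hlt.and ((Filter.eventually_gt_atTop 0).and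
    (tendsto_natCast_atTop_atTop.eventually_ge_atTop (a₀ / C)))).exists
  refine absurd hN (not_lt.2 ?_)
  have hNa' : a₀ ≤ C * N := by
    rw [div_le_iff₀ hC] at hNa
    linarith
  have hcount : (N : ℕ∞) ≤ (S ∩ Set.Icc (-(4 * C * N)) (4 * C * N)).encard := by
    have himg : (x '' (Set.Iio N)).encard = N := by
      rw [hinj.encard_image, ← Finset.coe_Iio, Set.encard_coe_eq_coe_finsetCard, Nat.card_Iio]
    rw [← himg]
    refine Set.encard_le_encard ?_
    rintro _ ⟨k, hk, rfl⟩
    have hk' : (k : ℝ) + 1 ≤ N := by exact_mod_cast hk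
    have h1 := abs_le.1 (hx k)
    have h2 : 3 * C * (k : ℝ) + 3 * C ≤ 3 * C * N := by nlinarith
    have h3 : 0 ≤ C * (k : ℝ) := by positivity
    have h4 : 0 ≤ C * (N : ℝ) := by positivity
    exact ⟨hxS k, by linarith, by linarith⟩
  have hN0' : (0 : ℝ) < N := by exact_mod_cast hN0
  rw [Function.comp_apply, ENNReal.le_div_iff_mul_le (Or.inl (by simp; positivity))
    (Or.inl ENNReal.ofReal_ne_top), ← ENNReal.ofReal_mul (by positivity)]
  have e : 1 / (8 * C) * (2 * (4 * C * (N : ℝ))) = N := by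
    field_simp
    ring
  rw [e, ENNReal.ofReal_natCast]
  exact_mod_cast ENat.toENNReal_le.2 hcount

/-- Otherwise `Z` would contain the part of `S` beyond `b` and be relatively dense itself. All later
uses of the density hypothesis go through this selection principle. -/
theorem RelativelyDenseAtTop.exists_mem_notMem {S Z : Set ℝ} (hS : RelativelyDenseAtTop S)
    (hZ : HasZeroDensity Z) (b : ℝ) : ∃ x ∈ S, x ∉ Z ∧ b < x := by
  by_contra! hcon
  refine RelativelyDenseAtTop.not_hasZeroDensity (S := Z) ?_ hZ
  obtain ⟨C, a₀, h⟩ := hS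
  refine ⟨C, max a₀ (b + C + 1), fun a ha => ?_⟩
  obtain ⟨x, hx, hxa⟩ := h a (le_trans (le_max_left _ _) ha)
  refine ⟨x, ?_, hxa⟩
  by_contra hxZ
  have h1 := hcon x hx hxZ
  have h2 := (abs_le.1 hxa).1
  have h3 := le_trans (le_max_right _ _) ha
  linarith

/-! ### Star map and relative density of model sets -/

namespace EuclideanCPS

variable {m : ℕ} (P : EuclideanCPS m) {x y : ℝ}

theorem star_mem (hx : x ∈ P.L) : (x, P.star x) ∈ P.lattice := by
  obtain ⟨y, hy⟩ := P.exists_of_mem_L hx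
  rwa [P.star_eq hy]

theorem mem_L_of_mem {p : ℝ × EuclideanSpace ℝ (Fin m)} (hp : p ∈ P.lattice) : p.1 ∈ P.L :=
  ⟨p, hp, rfl⟩

theorem star_fst {p : ℝ × EuclideanSpace ℝ (Fin m)} (hp : p ∈ P.lattice) : P.star p.1 = p.2 :=
  P.star_eq hp

theorem add_mem_L (hx : x ∈ P.L) (hy : y ∈ P.L) : x + y ∈ P.L :=
  P.mem_L_of_mem (P.lattice.add_mem (P.star_mem hx) (P.star_mem hy))

theorem sub_mem_L (hx : x ∈ P.L) (hy : y ∈ P.L) : x - y ∈ P.L :=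
  P.mem_L_of_mem (P.lattice.sub_mem (P.star_mem hx) (P.star_mem hy))

theorem star_add (hx : x ∈ P.L) (hy : y ∈ P.L) : P.star (x + y) = P.star x + P.star y :=
  P.star_eq (P.lattice.add_mem (P.star_mem hx) (P.star_mem hy))

theorem star_sub (hx : x ∈ P.L) (hy : y ∈ P.L) : P.star (x - y) = P.star x - P.star y :=
  P.star_eq (P.lattice.sub_mem (P.star_mem hx) (P.star_mem hy))

theorem star_zsmul (k : ℤ) (hx : x ∈ P.L) : P.star (k • x) = k • P.star x :=
  P.star_eq (P.lattice.smul_mem k (P.star_mem hx))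

theorem span_le_L {s : Set ℝ} (hs : s ⊆ P.L) :
    (Submodule.span ℤ s : Set ℝ) ⊆ P.L := by
  intro x hx
  have h : Submodule.span ℤ s ≤ P.lattice.map (LinearMap.fst ℤ ℝ (EuclideanSpace ℝ (Fin m))) :=
    Submodule.span_le.2 fun y hy => ⟨(y, P.star y), P.star_mem (hs hy), rfl⟩
  exact h hx

theorem exists_star_dist_lt (u : EuclideanSpace ℝ (Fin m)) {ε : ℝ} (hε : 0 < ε) :
    ∃ x ∈ P.L, ‖P.star x - u‖ < ε := by
  obtain ⟨_, h, ⟨p, hp, rfl⟩⟩ := Metric.dense_iff.1 P.dense_snd u ε hε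
  refine ⟨p.1, P.mem_L_of_mem hp, ?_⟩
  rwa [P.star_fst hp, ← dist_eq_norm]

theorem dense_star : Dense (P.star '' P.L) := by
  refine P.dense_snd.mono ?_
  rintro _ ⟨p, hp, rfl⟩
  exact ⟨p.1, P.mem_L_of_mem hp, P.star_fst hp⟩

/-- A lattice basis, viewed as a basis of the embedding space. -/
theorem exists_basis : ∃ (ι : Type) (_ : Fintype ι)
    (b : Module.Basis ι ℝ (ℝ × EuclideanSpace ℝ (Fin m))),
    Submodule.span ℤ (Set.range b) = P.lattice := by
  have := P.discrete
  have := P.isZLattice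
  have := ZLattice.module_free ℝ P.lattice
  have := ZLattice.module_finite ℝ P.lattice
  exact ⟨_, inferInstance, (Module.finBasis ℤ P.lattice).ofZLatticeBasis ℝ P.lattice,
    Module.Basis.ofZLatticeBasis_span _ _ _⟩

theorem exists_lattice_dist_le : ∃ D : ℝ, ∀ q : ℝ × EuclideanSpace ℝ (Fin m),
    ∃ p ∈ P.lattice, ‖q - p‖ ≤ D := by
  obtain ⟨ι, _, b, hb⟩ := P.exists_basis
  refine ⟨∑ i, ‖b i‖, fun q => ⟨ZSpan.floor b q, ?_, ?_⟩⟩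
  · rw [← hb]
    exact (ZSpan.floor b q).2
  · exact ZSpan.norm_fract_le b q

/-- Some lattice point lies within the covering radius `D` of `(a, 0)`. By density and compactness,
finitely many corrections `w ∈ L` suffice to move any internal coordinate of norm at most `D` into
`U`, at bounded cost in physical space. -/
theorem relativelyDenseAtTop_cutProject {U : Set (EuclideanSpace ℝ (Fin m))} (hU : IsOpen U)
    (hne : U.Nonempty) : RelativelyDenseAtTop (P.cutProject U) := by
  obtain ⟨u, hu⟩ := hne
  obtain ⟨ε, hε, hball⟩ := Metric.isOpen_iff.1 hU u hu
  obtain ⟨D, hD⟩ := P.exists_lattice_dist_le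
  obtain ⟨t, htL, htf, htc⟩ := (isCompact_closedBall 0 D).elim_finite_subcover_image
    (b := P.L) (c := fun w => Metric.ball (u - P.star w) ε) (fun _ _ => Metric.isOpen_ball)
    (fun v _ => by
      obtain ⟨w, hw, h⟩ := P.exists_star_dist_lt (u - v) hε
      refine Set.mem_biUnion hw ?_
      rw [Metric.mem_ball, dist_eq_norm]
      rwa [show v - (u - P.star w) = P.star w - (u - v) by abel])
  obtain ⟨K, hK⟩ := htf.isBounded.exists_norm_le
  refine ⟨D + K, 0, fun a _ => ?_⟩
  obtain ⟨p, hp, hpD⟩ := hD (a, 0)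
  have hp2 : p.2 ∈ Metric.closedBall 0 D := by
    simpa using (norm_snd_le _).trans hpD
  obtain ⟨w, hwt, hw⟩ := Set.mem_iUnion₂.1 (htc hp2)
  have hpL := P.mem_L_of_mem hp
  refine ⟨p.1 + w, ⟨P.add_mem_L hpL (htL hwt), hball ?_⟩, ?_⟩
  · rw [Metric.mem_ball, dist_eq_norm] at hw ⊢
    rw [P.star_add hpL (htL hwt), P.star_fst hp]
    convert hw using 2
    abel
  · have h1 : |p.1 - a| ≤ D := by
      rw [abs_sub_comm]
      exact (norm_fst_le _).trans hpD
    calc |p.1 + w - a| = |(p.1 - a) + w| := by ring_nf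
      _ ≤ |p.1 - a| + |w| := abs_add_le _ _
      _ ≤ D + K := add_le_add h1 (hK w hwt)

end EuclideanCPS

/-! ### Displacements and the module of tile lengths -/

theorem List.card_filter_range_getElem?_eq {α : Type*} [DecidableEq α] (l : List α) (a : α) :
    ((Finset.range l.length).filter fun p => l[p]? = some a).card = l.count a := by
  induction l using List.reverseRecOn with
  | nil => simp
  | append_singleton l b ih =>
    have hfilter : (Finset.range l.length).filter (fun p => (l ++ [b])[p]? = some a) =
        (Finset.range l.length).filter (fun p => l[p]? = some a) := by
      refine Finset.filter_congr fun p hp => ?_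
      rw [List.getElem?_append_left (Finset.mem_range.1 hp)]
    rw [List.length_append, List.length_singleton, Finset.range_add_one, Finset.filter_insert,
      hfilter, List.count_append, List.count_singleton]
    by_cases hb : b = a <;> simp [hb, ih]

theorem List.sum_map_take_add_le {α : Type*} (l : List α) {f : α → ℝ} (hf : ∀ a, 0 < f a)
    {p q : ℕ} {a : α} (hp : l[p]? = some a) (hpq : p < q) :
    ((l.take p).map f).sum + f a ≤ ((l.take q).map f).sum := by
  have hsucc : ((l.take (p + 1)).map f).sum = ((l.take p).map f).sum + f a := by
    rw [List.take_add_one, hp]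
    simp
  obtain ⟨d, rfl⟩ : ∃ d, q = (p + 1) + d := ⟨q - (p + 1), by omega⟩
  rw [List.take_add (i := p + 1), List.map_append, List.sum_append, hsucc]
  refine le_add_of_nonneg_right (List.sum_nonneg fun x hx => ?_)
  obtain ⟨y, _, rfl⟩ := List.mem_map.1 hx
  exact (hf y).le

namespace Inflation

variable {n : ℕ} (ϱ : Inflation n)

theorem mem_displacement {i j : Fin n} {t : ℝ} : t ∈ ϱ.displacement i j ↔
    ∃ p < (ϱ.word j).length, (ϱ.word j)[p]? = some i ∧
      (((ϱ.word j).take p).map ϱ.tileLength).sum = t := by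
  simp [displacement, and_assoc]

theorem sum_matrix_mul_tileLength (j : Fin n) :
    ∑ i, ϱ.tileLength i * (ϱ.matrix i j : ℝ) = ϱ.factor * ϱ.tileLength j := by
  simpa [Matrix.vecMul, dotProduct] using congrFun ϱ.eigenvector j

theorem sum_count_mul_tileLength (j : Fin n) :
    ∑ i, ϱ.tileLength i * ((ϱ.word j).count i : ℝ) = ϱ.factor * ϱ.tileLength j := by
  rw [← ϱ.sum_matrix_mul_tileLength]
  simp [Substitution.matrix]

theorem sum_map_tileLength_word (j : Fin n) :
    ((ϱ.word j).map ϱ.tileLength).sum = ϱ.factor * ϱ.tileLength j := by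
  rw [← ϱ.sum_count_mul_tileLength, Finset.sum_list_map_count]
  refine (Finset.sum_subset (Finset.subset_univ _) fun i _ hi => ?_).trans
    (Finset.sum_congr rfl fun i _ => ?_)
  · rw [List.count_eq_zero_of_not_mem (by simpa using hi), zero_smul]
  · rw [nsmul_eq_mul, mul_comm]

theorem displacement_nonneg {i j : Fin n} {t : ℝ} (ht : t ∈ ϱ.displacement i j) : 0 ≤ t := by
  obtain ⟨p, _, _, rfl⟩ := ϱ.mem_displacement.1 ht
  refine List.sum_nonneg fun x hx => ?_
  obtain ⟨y, _, rfl⟩ := List.mem_map.1 hx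
  exact (ϱ.tileLength_pos y).le

theorem displacement_add_tileLength_le {i j : Fin n} {t : ℝ} (ht : t ∈ ϱ.displacement i j) :
    t + ϱ.tileLength i ≤ ϱ.factor * ϱ.tileLength j := by
  obtain ⟨p, hp, hpi, rfl⟩ := ϱ.mem_displacement.1 ht
  have h := (ϱ.word j).sum_map_take_add_le ϱ.tileLength_pos hpi hp
  rwa [List.take_length, ϱ.sum_map_tileLength_word] at h

/-- Positive tile lengths put distinct occurrences of a letter at distinct positions, so passing to
a set of positions loses no multiplicity. -/
theorem card_displacement (i j : Fin n) :
    (ϱ.displacement i j).card = (ϱ.word j).count i := by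
  rw [displacement, Finset.card_image_of_injOn, List.card_filter_range_getElem?_eq]
  intro p hp q hq hpq
  have hp' := (Finset.mem_filter.1 hp).2
  have hq' := (Finset.mem_filter.1 hq).2
  by_contra hne
  have hpos := ϱ.tileLength_pos i
  rcases lt_or_gt_of_ne hne with h | h
  · have := (ϱ.word j).sum_map_take_add_le ϱ.tileLength_pos hp' h
    simp only at hpq
    linarith
  · have := (ϱ.word j).sum_map_take_add_le ϱ.tileLength_pos hq' h
    simp only at hpq
    linarith

theorem sum_card_displacement_mul_tileLength (j : Fin n) :
    ∑ i, ϱ.tileLength i * ((ϱ.displacement i j).card : ℝ) = ϱ.factor * ϱ.tileLength j := by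
  simp only [card_displacement, sum_count_mul_tileLength]

theorem exists_zero_mem_displacement (j : Fin n) : ∃ i, (0 : ℝ) ∈ ϱ.displacement i j := by
  have hlen : 0 < (ϱ.word j).length := List.length_pos_of_ne_nil (ϱ.word_ne_nil j)
  exact ⟨(ϱ.word j)[0], ϱ.mem_displacement.2 ⟨0, hlen, by simp, by simp⟩⟩

/-- The `ℤ`-module generated by the tile lengths. -/
def lengthModule : Submodule ℤ ℝ := Submodule.span ℤ (Set.range ϱ.tileLength)

theorem tileLength_mem_lengthModule (i : Fin n) : ϱ.tileLength i ∈ ϱ.lengthModule :=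
  Submodule.subset_span ⟨i, rfl⟩

theorem tileLength_mul_mem_lengthModule (i : Fin n) (k : ℤ) :
    ϱ.tileLength i * (k : ℝ) ∈ ϱ.lengthModule := by
  rw [mul_comm, ← zsmul_eq_mul]
  exact Submodule.smul_mem _ k (ϱ.tileLength_mem_lengthModule i)

theorem displacement_mem_lengthModule {i j : Fin n} {t : ℝ} (ht : t ∈ ϱ.displacement i j) :
    t ∈ ϱ.lengthModule := by
  obtain ⟨p, _, _, rfl⟩ := ϱ.mem_displacement.1 ht
  refine list_sum_mem fun x hx => ?_
  obtain ⟨y, _, rfl⟩ := List.mem_map.1 hx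
  exact ϱ.tileLength_mem_lengthModule y

theorem mul_mem_lengthModule {c : ℝ} (h : ∀ j, c * ϱ.tileLength j ∈ ϱ.lengthModule) {x : ℝ}
    (hx : x ∈ ϱ.lengthModule) : c * x ∈ ϱ.lengthModule := by
  induction hx using Submodule.span_induction with
  | mem x hx =>
    obtain ⟨j, rfl⟩ := hx
    exact h j
  | zero => simp
  | add x y _ _ hx hy =>
    rw [mul_add]
    exact add_mem hx hy
  | smul k x _ hx =>
    rw [mul_smul_comm]
    exact Submodule.smul_mem _ k hx

theorem factor_mul_mem_lengthModule {x : ℝ} (hx : x ∈ ϱ.lengthModule) :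
    ϱ.factor * x ∈ ϱ.lengthModule := by
  refine ϱ.mul_mem_lengthModule (fun j => ?_) hx
  rw [← ϱ.sum_matrix_mul_tileLength]
  exact sum_mem fun i _ => ϱ.tileLength_mul_mem_lengthModule i _

theorem inv_factor_mul_mem_lengthModule (hu : ϱ.Unimodular) (h0 : ϱ.factor ≠ 0) {x : ℝ}
    (hx : x ∈ ϱ.lengthModule) : ϱ.factor⁻¹ * x ∈ ϱ.lengthModule := by
  refine ϱ.mul_mem_lengthModule (fun j => ?_) hx
  -- The integer inverse of the substitution matrix: as `det = ±1`, the factor `det` equals `1/det`.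
  set B : Matrix (Fin n) (Fin n) ℤ := ϱ.matrix.det • ϱ.matrix.adjugate with hB
  have hMB : ϱ.matrix * B = 1 := by
    have hdet : ϱ.matrix.det * ϱ.matrix.det = 1 := by
      rw [← abs_mul_abs_self, show |ϱ.matrix.det| = 1 from hu, one_mul]
    rw [hB, Matrix.mul_smul, Matrix.mul_adjugate, smul_smul, hdet, one_smul]
  have hMB' : ϱ.matrix.map (Int.cast : ℤ → ℝ) * B.map (Int.cast : ℤ → ℝ) = 1 := by
    have h := congrArg (Int.castRingHom ℝ).mapMatrix hMB
    rwa [map_mul, map_one] at h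
  have hvec := congrArg (fun v => Matrix.vecMul v (B.map (Int.cast : ℤ → ℝ))) ϱ.eigenvector
  simp only [Matrix.vecMul_vecMul, hMB', Matrix.vecMul_one, Matrix.smul_vecMul] at hvec
  have hj : ϱ.factor⁻¹ * ϱ.tileLength j = ∑ i, ϱ.tileLength i * (B i j : ℝ) := by
    rw [congrFun hvec j, Pi.smul_apply, smul_eq_mul, inv_mul_cancel_left₀ h0]
    simp [Matrix.vecMul, dotProduct]
  rw [hj]
  exact sum_mem fun i _ => ϱ.tileLength_mul_mem_lengthModule i _

/-! ### Tilings and the fixed point equation -/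

namespace Tiling

variable {ϱ} (τ : ϱ.Tiling)

theorem mem_controlPoints {i : Fin n} {x : ℝ} :
    x ∈ τ.controlPoints i ↔ ∃ k, τ.pos k = x ∧ τ.letter k = i := by
  simp [controlPoints, tiles]

theorem pos_strictMono : StrictMono τ.pos :=
  strictMono_int_of_lt_succ fun k => by
    rw [τ.pos_succ]
    exact lt_add_of_pos_right _ (ϱ.tileLength_pos _)

theorem index_le_of_mem {k l : ℤ} {z : ℝ} (hk : τ.pos k ≤ z)
    (hl : z < τ.pos l + ϱ.tileLength (τ.letter l)) : k ≤ l := by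
  rw [← τ.pos_succ] at hl
  have := τ.pos_strictMono.lt_iff_lt.1 (hk.trans_lt hl)
  omega

theorem pos_sub_pos_mem_lengthModule (k l : ℤ) : τ.pos k - τ.pos l ∈ ϱ.lengthModule := by
  have h : ∀ k, τ.pos k - τ.pos 0 ∈ ϱ.lengthModule := by
    intro k
    induction k using Int.induction_on with
    | zero => simp
    | succ k ih =>
      rw [τ.pos_succ, add_sub_right_comm]
      exact add_mem ih (ϱ.tileLength_mem_lengthModule _)
    | pred k ih =>
      have e := τ.pos_succ (-(k : ℤ) - 1)
      rw [sub_add_cancel] at e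
      rw [e, add_sub_right_comm] at ih
      exact (Submodule.add_mem_iff_left _ (ϱ.tileLength_mem_lengthModule _)).1 ih
  simpa using sub_mem (h k) (h l)

variable {τ}

theorem IsFixedPoint.factor_mul_add_mem (hτ : τ.IsFixedPoint) {i j : Fin n} {x t : ℝ}
    (hx : x ∈ τ.controlPoints j) (ht : t ∈ ϱ.displacement i j) :
    ϱ.factor * x + t ∈ τ.controlPoints i := by
  have h : (ϱ.factor * x + t, i) ∈ ϱ.inflate τ.tiles := ⟨(x, j), hx, t, ht, rfl⟩
  rwa [hτ] at h

theorem IsFixedPoint.exists_eq_factor_mul_add (hτ : τ.IsFixedPoint) {i : Fin n} {y : ℝ}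
    (hy : y ∈ τ.controlPoints i) :
    ∃ j, ∃ t ∈ ϱ.displacement i j, ∃ x ∈ τ.controlPoints j, y = ϱ.factor * x + t := by
  have h : (y, i) ∈ ϱ.inflate τ.tiles := by
    rw [hτ]
    exact hy
  obtain ⟨⟨x, j⟩, hp, t, ht, h⟩ := h
  exact ⟨j, t, ht, x, hp, h⟩

/-- Supertiles do not overlap: after division by `λ`, the common point lies in the half-open tiles
based at `x` and at `x'`, and distinct half-open tiles are disjoint. -/
theorem eq_of_factor_mul_add_eq (hpos : 0 < ϱ.factor) {i i' j j' : Fin n} {x x' t t' : ℝ}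
    (hx : x ∈ τ.controlPoints j) (hx' : x' ∈ τ.controlPoints j') (ht : t ∈ ϱ.displacement i j)
    (ht' : t' ∈ ϱ.displacement i' j') (h : ϱ.factor * x + t = ϱ.factor * x' + t') :
    j = j' ∧ x = x' := by
  obtain ⟨k, rfl, rfl⟩ := τ.mem_controlPoints.1 hx
  obtain ⟨l, rfl, rfl⟩ := τ.mem_controlPoints.1 hx'
  have hz : τ.pos k + t / ϱ.factor = τ.pos l + t' / ϱ.factor := by
    field_simp
    linarith
  have hlt : ∀ {i k t}, t ∈ ϱ.displacement i (τ.letter k) →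
      τ.pos k ≤ τ.pos k + t / ϱ.factor ∧
        τ.pos k + t / ϱ.factor < τ.pos k + ϱ.tileLength (τ.letter k) := by
    intro i k t ht
    refine ⟨le_add_of_nonneg_right (div_nonneg (ϱ.displacement_nonneg ht) hpos.le), ?_⟩
    have h1 := ϱ.displacement_add_tileLength_le ht
    have h2 := ϱ.tileLength_pos i
    rw [add_lt_add_iff_left, div_lt_iff₀' hpos]
    linarith
  obtain rfl : k = l := le_antisymm
    (τ.index_le_of_mem (hlt ht).1 (hz ▸ (hlt ht').2))
    (τ.index_le_of_mem (hlt ht').1 (hz ▸ (hlt ht).2))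
  exact ⟨rfl, rfl⟩

/-- Every control point has exactly one predecessor `(k, r)`: existence is the fixed point property,
uniqueness is the disjointness of supertiles. -/
theorem IsFixedPoint.sum_indicator_eq (hτ : τ.IsFixedPoint) (hpos : 0 < ϱ.factor)
    (i : Fin n) (y : ℝ) :
    ∑ k, ∑ r ∈ ϱ.displacement i k,
      (τ.controlPoints k).indicator (fun _ => (1 : ℝ)) (ϱ.factor⁻¹ * (y - r)) =
    (τ.controlPoints i).indicator (fun _ => (1 : ℝ)) y := by
  have hback : ∀ r, ϱ.factor * (ϱ.factor⁻¹ * (y - r)) + r = y := fun r => by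
    rw [mul_inv_cancel_left₀ hpos.ne', sub_add_cancel]
  by_cases hy : y ∈ τ.controlPoints i
  · obtain ⟨j, t, ht, x, hx, hxy⟩ := hτ.exists_eq_factor_mul_add hy
    have hzero : ∀ k, ∀ r ∈ ϱ.displacement i k, (k ≠ j ∨ r ≠ t) →
        (τ.controlPoints k).indicator (fun _ => (1 : ℝ)) (ϱ.factor⁻¹ * (y - r)) = 0 := by
      intro k r hr hne
      refine Set.indicator_of_notMem (fun hmem => ?_) _
      obtain ⟨hkj, he⟩ := eq_of_factor_mul_add_eq hpos hmem hx hr ht ((hback r).trans hxy)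
      rcases hne with h | h
      · exact h hkj
      · have h1 := hback r
        rw [he, hxy] at h1
        exact h (add_left_cancel h1)
    rw [Finset.sum_eq_single j (fun k _ hk => Finset.sum_eq_zero fun r hr =>
        hzero k r hr (Or.inl hk)) (by simp),
      Finset.sum_eq_single_of_mem t ht (fun r hr hne => hzero j r hr (Or.inr hne)),
      Set.indicator_of_mem hy, Set.indicator_of_mem]
    rwa [hxy, add_sub_cancel_right, inv_mul_cancel_left₀ hpos.ne']
  · rw [Set.indicator_of_notMem hy]
    refine Finset.sum_eq_zero fun k _ => Finset.sum_eq_zero fun r hr =>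
      Set.indicator_of_notMem (fun hmem => hy ?_) _
    rw [← hback r]
    exact hτ.factor_mul_add_mem hmem hr

end Tiling

end Inflation

/-! ### Generating `L`, and linear maps on internal space -/

namespace EuclideanCPS

variable {m : ℕ} (P : EuclideanCPS m)

/-- A `ℤ`-module that contains the points of `L` with small star image contains `L`. -/
theorem L_subset_of_small_star_mem (R : Submodule ℤ ℝ) {ε : ℝ} (hε : 0 < ε)
    (hR : ∀ z ∈ P.L, ‖P.star z‖ < ε → z ∈ R) : P.L ⊆ R := by
  have key : ∀ (N : ℕ), ∀ z ∈ P.L, ‖P.star z‖ < 2 ^ N * ε → z ∈ R := by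
    intro N
    induction N with
    | zero => simpa using hR
    | succ N ih =>
      intro z hz hzN
      rw [pow_succ] at hzN
      -- Halving: split `z = w + (z - w)` with `w^⋆` so close to `z^⋆/2` that both summands fall
      -- under the bound `2^N ε`.
      have hδ : 0 < 2 ^ N * ε - ‖P.star z‖ / 2 := by linarith
      obtain ⟨w, hw, hwz⟩ := P.exists_star_dist_lt ((1 / 2 : ℝ) • P.star z) hδ
      have hhalf : ‖(1 / 2 : ℝ) • P.star z‖ = ‖P.star z‖ / 2 := by
        rw [norm_smul]
        norm_num
        ring
      have h1 : w ∈ R := by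
        refine ih w hw ?_
        have := norm_add_le (P.star w - (1 / 2 : ℝ) • P.star z) ((1 / 2 : ℝ) • P.star z)
        rw [sub_add_cancel] at this
        linarith
      have h2 : z - w ∈ R := by
        refine ih _ (P.sub_mem_L hz hw) ?_
        have e : P.star (z - w) =
            (1 / 2 : ℝ) • P.star z - (P.star w - (1 / 2 : ℝ) • P.star z) := by
          rw [P.star_sub hz hw]
          module
        have := norm_sub_le ((1 / 2 : ℝ) • P.star z) (P.star w - (1 / 2 : ℝ) • P.star z)
        rw [e]
        linarith
      simpa using add_mem h2 h1
  intro z hz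
  obtain ⟨N, hN⟩ := pow_unbounded_of_one_lt (‖P.star z‖ / ε) one_lt_two
  exact key N z hz ((div_lt_iff₀ hε).1 hN)

/-- If multiplication by `c` preserves `L`, then the star map intertwines it with a linear map
on the embedding space. -/
theorem exists_linearMap_star_mul {c : ℝ} (hc : ∀ x ∈ P.L, c * x ∈ P.L) :
    ∃ (v : EuclideanSpace ℝ (Fin m))
      (A : EuclideanSpace ℝ (Fin m) →ₗ[ℝ] EuclideanSpace ℝ (Fin m)),
      ∀ x ∈ P.L, P.star (c * x) = x • v + A (P.star x) := by
  obtain ⟨ι, _, b, hb⟩ := P.exists_basis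
  have hbmem : ∀ i, b i ∈ P.lattice := fun i => by
    rw [← hb]
    exact Submodule.subset_span ⟨i, rfl⟩
  -- A lattice basis is also a real basis, so the additive map `(x, x^⋆) ↦ (cx)^⋆` extends linearly
  -- to the whole embedding space.
  let B : (ℝ × EuclideanSpace ℝ (Fin m)) →ₗ[ℝ] EuclideanSpace ℝ (Fin m) :=
    b.constr ℝ fun i => P.star (c * (b i).1)
  have hB : ∀ p ∈ P.lattice, B p = P.star (c * p.1) := by
    intro p hp
    have hp' := hp
    rw [← hb] at hp'
    induction hp' using Submodule.span_induction with
    | mem x hx =>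
      obtain ⟨i, rfl⟩ := hx
      exact b.constr_basis ℝ _ i
    | zero =>
      rw [map_zero, Prod.fst_zero, mul_zero]
      exact (P.star_fst P.lattice.zero_mem).symm
    | add x y hx hy ihx ihy =>
      rw [hb] at hx hy
      rw [map_add, ihx hx, ihy hy, Prod.fst_add, mul_add,
        P.star_add (hc _ (P.mem_L_of_mem hx)) (hc _ (P.mem_L_of_mem hy))]
    | smul k x hx ihx =>
      rw [hb] at hx
      rw [map_zsmul, ihx hx, Prod.smul_fst, mul_smul_comm,
        P.star_zsmul k (hc _ (P.mem_L_of_mem hx))]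
  refine ⟨B (1, 0), B ∘ₗ LinearMap.inr ℝ ℝ _, fun x hx => ?_⟩
  rw [← hB _ (P.star_mem hx), ← map_smul, LinearMap.comp_apply, ← map_add]
  simp

theorem IsStarDilation.unique {c : ℝ}
    {A A' : EuclideanSpace ℝ (Fin m) ≃L[ℝ] EuclideanSpace ℝ (Fin m)}
    (hA : P.IsStarDilation c A) (hA' : P.IsStarDilation c A') : A = A' := by
  have h : (A : EuclideanSpace ℝ (Fin m) → EuclideanSpace ℝ (Fin m)) = A' := by
    refine Continuous.ext_on P.dense_star A.continuous A'.continuous ?_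
    rintro _ ⟨x, hx, rfl⟩
    rw [← (hA x hx).2, ← (hA' x hx).2]
  exact ContinuousLinearEquiv.ext h

/-- A linear map that the star map intertwines with a bijection of `L` is invertible. -/
theorem exists_isStarDilation {c : ℝ} (hc0 : c ≠ 0) (hc : ∀ x ∈ P.L, c * x ∈ P.L)
    (hc' : ∀ x ∈ P.L, c⁻¹ * x ∈ P.L)
    {A : EuclideanSpace ℝ (Fin m) →ₗ[ℝ] EuclideanSpace ℝ (Fin m)}
    (hA : ∀ x ∈ P.L, P.star (c * x) = A (P.star x)) :
    ∃ A' : EuclideanSpace ℝ (Fin m) ≃L[ℝ] EuclideanSpace ℝ (Fin m), P.IsStarDilation c A' := by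
  have hsub : P.star '' P.L ⊆ (LinearMap.range A : Set (EuclideanSpace ℝ (Fin m))) := by
    rintro _ ⟨x, hx, rfl⟩
    refine ⟨P.star (c⁻¹ * x), ?_⟩
    rw [← hA _ (hc' x hx), mul_inv_cancel_left₀ hc0]
  -- The range is a closed subspace containing the dense set `L^⋆`.
  have hsurj : Function.Surjective A := by
    intro y
    have hclosed := (LinearMap.range A).closed_of_finiteDimensional
    have hy : y ∈ closure (P.star '' P.L) := P.dense_star y
    exact closure_minimal hsub hclosed hy
  have hinj : Function.Injective A := LinearMap.injective_iff_surjective.2 hsurj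
  refine ⟨(LinearEquiv.ofBijective A ⟨hinj, hsurj⟩).toContinuousLinearEquiv, fun x hx =>
    ⟨hc x hx, ?_⟩⟩
  rw [hA x hx]
  rfl

end EuclideanCPS

/-! ### The module `L` and the star dilation of a tiling -/

namespace Inflation.Tiling

variable {n m : ℕ} {ϱ : Inflation n} (τ : ϱ.Tiling) (P : EuclideanCPS m)
  (W : Fin n → Set (EuclideanSpace ℝ (Fin m)))

/-- The points at which the tiling differs from the model sets. -/
def defect : Set ℝ := ⋃ i, symmDiff (τ.controlPoints i) (P.cutProject (W i))

variable {τ P W}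

theorem mem_controlPoints_iff_of_notMem_defect {x : ℝ} (hx : x ∉ τ.defect P W) (i : Fin n) :
    x ∈ τ.controlPoints i ↔ x ∈ P.cutProject (W i) := by
  simp only [defect, Set.mem_iUnion, not_exists, Set.mem_symmDiff, not_or] at hx
  have := hx i
  tauto

/-- A tile length is the difference of two consecutive control points; the left one is chosen so
that neither endpoint belongs to the defect, which puts both in `L`. -/
theorem tileLength_mem_L (hW : ∀ i, (interior (W i)).Nonempty)
    (hZ : HasZeroDensity (τ.defect P W)) (i : Fin n) : ϱ.tileLength i ∈ P.L := by
  obtain ⟨x, hx, hxZ, _⟩ := (P.relativelyDenseAtTop_cutProject isOpen_interior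
    (hW i)).exists_mem_notMem (hZ.union (hZ.preimage_affine one_ne_zero (ϱ.tileLength i))) 0
  simp only [Set.mem_union, Set.mem_ofPred_eq, one_mul, not_or] at hxZ
  have hxi : x ∈ τ.controlPoints i :=
    (mem_controlPoints_iff_of_notMem_defect hxZ.1 i).2 ⟨hx.1, interior_subset hx.2⟩
  obtain ⟨k, rfl, rfl⟩ := τ.mem_controlPoints.1 hxi
  have h : τ.pos k + ϱ.tileLength (τ.letter k) ∈ P.L :=
    ((mem_controlPoints_iff_of_notMem_defect hxZ.2 (τ.letter (k + 1))).1
      (τ.mem_controlPoints.2 ⟨k + 1, τ.pos_succ k, rfl⟩)).1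
  simpa using P.sub_mem_L h hx.1

/-- Differences of control points are integer combinations of tile lengths. Any `z ∈ L` with small
`z^⋆` is such a difference, and these `z` generate `L`. -/
theorem L_eq_lengthModule (hW : ∀ i, (interior (W i)).Nonempty)
    (hZ : HasZeroDensity (τ.defect P W)) : P.L = ϱ.lengthModule := by
  refine Set.Subset.antisymm ?_ (P.span_le_L ?_)
  · let i := τ.letter 0
    obtain ⟨u, hu⟩ := hW i
    obtain ⟨ε, hε, hball⟩ := Metric.isOpen_iff.1 isOpen_interior u hu
    refine P.L_subset_of_small_star_mem _ hε fun z hz hzε => ?_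
    -- Internal points that stay in the interior of the window when shifted by `z^⋆`; `u` is one of
    -- them since `‖z^⋆‖ < ε`.
    have hopen : IsOpen (interior (W i) ∩ (fun v => v + P.star z) ⁻¹' interior (W i)) :=
      isOpen_interior.inter (isOpen_interior.preimage (by fun_prop))
    obtain ⟨x, hx, hxZ, _⟩ := (P.relativelyDenseAtTop_cutProject hopen
      ⟨u, hu, hball (by simpa [dist_eq_norm] using hzε)⟩).exists_mem_notMem
      (hZ.union (hZ.preimage_affine one_ne_zero z)) 0
    simp only [Set.mem_union, Set.mem_ofPred_eq, one_mul, not_or] at hxZ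
    obtain ⟨hxL, hx1, hx2⟩ := hx
    have h1 : x ∈ τ.controlPoints i :=
      (mem_controlPoints_iff_of_notMem_defect hxZ.1 i).2 ⟨hxL, interior_subset hx1⟩
    have h2 : x + z ∈ τ.controlPoints i := by
      refine (mem_controlPoints_iff_of_notMem_defect hxZ.2 i).2 ⟨P.add_mem_L hxL hz, ?_⟩
      rw [P.star_add hxL hz]
      exact interior_subset hx2
    obtain ⟨k, hk, _⟩ := τ.mem_controlPoints.1 h1
    obtain ⟨l, hl, _⟩ := τ.mem_controlPoints.1 h2
    have h := τ.pos_sub_pos_mem_lengthModule l k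
    rwa [hk, hl, add_sub_cancel_left] at h
  · rintro _ ⟨i, rfl⟩
    exact tileLength_mem_L hW hZ i

theorem exists_isStarDilation (hτ : τ.IsFixedPoint) (hu : ϱ.Unimodular) (hpos : 0 < ϱ.factor)
    (hW : ∀ i, (interior (W i)).Nonempty) (hbdd : ∀ i, IsCompact (closure (W i)))
    (hZ : HasZeroDensity (τ.defect P W)) :
    ∃ A : EuclideanSpace ℝ (Fin m) ≃L[ℝ] EuclideanSpace ℝ (Fin m),
      P.IsStarDilation ϱ.factor A := by
  have hL := L_eq_lengthModule hW hZ
  have hmul : ∀ x ∈ P.L, ϱ.factor * x ∈ P.L := fun x hx => by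
    rw [hL] at hx ⊢
    exact ϱ.factor_mul_mem_lengthModule hx
  have hmul' : ∀ x ∈ P.L, ϱ.factor⁻¹ * x ∈ P.L := fun x hx => by
    rw [hL] at hx ⊢
    exact ϱ.inv_factor_mul_mem_lengthModule hu hpos.ne' hx
  obtain ⟨v, A, hA⟩ := P.exists_linearMap_star_mul hmul
  suffices hv : v = 0 from
    P.exists_isStarDilation hpos.ne' hmul hmul' fun x hx => by rw [hA x hx, hv, smul_zero, zero_add]
  let j := τ.letter 0
  -- Type of the first tile in the supertile of `j`: then `x ∈ Λ_j` gives `λx ∈ Λ_i`. Off the defect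
  -- both star images are bounded, hence so is `x v`, although `x` is arbitrarily large.
  obtain ⟨i, hi⟩ := ϱ.exists_zero_mem_displacement j
  obtain ⟨K, hK⟩ := ((hbdd i).isBounded.subset subset_closure).exists_norm_le
  obtain ⟨K', hK'⟩ := (((hbdd j).image A.continuous_of_finiteDimensional).isBounded.subset
    (Set.image_mono subset_closure)).exists_norm_le
  have hbound : ∀ b : ℝ, ∃ x, b < x ∧ ‖x • v‖ ≤ K + K' := by
    intro b
    obtain ⟨x, hx, hxZ, hbx⟩ := (P.relativelyDenseAtTop_cutProject isOpen_interior
      (hW j)).exists_mem_notMem (hZ.union (hZ.preimage_affine hpos.ne' 0)) b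
    simp only [Set.mem_union, Set.mem_ofPred_eq, add_zero, not_or] at hxZ
    have hxW : P.star x ∈ W j := interior_subset hx.2
    have h1 := (mem_controlPoints_iff_of_notMem_defect hxZ.1 j).2 ⟨hx.1, hxW⟩
    have h2 := hτ.factor_mul_add_mem h1 hi
    rw [add_zero, mem_controlPoints_iff_of_notMem_defect hxZ.2 i] at h2
    refine ⟨x, hbx, ?_⟩
    rw [eq_sub_of_add_eq (hA x hx.1).symm]
    exact (norm_sub_le _ _).trans (add_le_add (hK _ h2.2) (hK' _ ⟨_, hxW, rfl⟩))
  by_contra hv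
  have hv' : 0 < ‖v‖ := norm_pos_iff.2 hv
  obtain ⟨x, hx, hxv⟩ := hbound (max 0 ((K + K') / ‖v‖))
  have hx0 : 0 < x := (le_max_left _ _).trans_lt hx
  have hx1 := (div_lt_iff₀ hv').1 ((le_max_right _ _).trans_lt hx)
  rw [norm_smul, Real.norm_of_nonneg hx0.le] at hxv
  linarith

end Inflation.Tiling

/-! ### Null boundaries, affine changes of variables, covariograms -/

section

open MeasureTheory Filter Topology

theorem eventually_mem_iff_of_notMem_frontier {X : Type*} [TopologicalSpace X] {s : Set X} {x : X}
    (hx : x ∉ frontier s) : ∀ᶠ y in 𝓝 x, (y ∈ s ↔ x ∈ s) := by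
  by_cases hs : x ∈ s
  · have hint : x ∈ interior s := by
      by_contra h
      exact hx ⟨subset_closure hs, h⟩
    filter_upwards [mem_interior_iff_mem_nhds.1 hint] with y hy
    exact iff_of_true hy hs
  · have hcl : x ∉ closure s := fun h => hx ⟨h, fun h' => hs (interior_subset h')⟩
    filter_upwards [isClosed_closure.isOpen_compl.mem_nhds hcl] with y hy
    exact iff_of_false (fun h => hy (subset_closure h)) hs

theorem Set.indicator_one_eq_of_mem_iff {X Y : Type*} {s : Set X} {t : Set Y} {x : X} {y : Y}
    (h : x ∈ s ↔ y ∈ t) :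
    s.indicator (fun _ => (1 : ℝ)) x = t.indicator (fun _ => (1 : ℝ)) y := by
  by_cases hx : x ∈ s
  · rw [Set.indicator_of_mem hx, Set.indicator_of_mem (h.1 hx)]
  · rw [Set.indicator_of_notMem hx, Set.indicator_of_notMem (mt h.2 hx)]

section AffineChange

variable {E : Type*} [NormedAddCommGroup E] [NormedSpace ℝ E] [MeasurableSpace E] [BorelSpace E]
  [FiniteDimensional ℝ E] (μ : Measure E) [μ.IsAddHaarMeasure]

/-- The inverse of the affine map `u ↦ A u + c`. -/
def affineInverse (A : E ≃L[ℝ] E) (c : E) : E ≃ₜ E :=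
  (Homeomorph.subRight c).trans A.symm.toHomeomorph

theorem map_affineInverse (A : E ≃L[ℝ] E) (c : E) :
    Measure.map (affineInverse A c).toMeasurableEquiv μ =
      ENNReal.ofReal |LinearMap.det (A : E →ₗ[ℝ] E)| • μ := by
  ext s _
  rw [(affineInverse A c).toMeasurableEquiv.map_apply]
  have h := μ.addHaar_preimage_continuousLinearEquiv A.symm s
  have h' := measure_preimage_add_right μ (-c) (A.symm ⁻¹' s)
  simp only [← sub_eq_add_neg] at h'
  exact h'.trans h

theorem integral_comp_affineInverse (A : E ≃L[ℝ] E) (c : E) (f : E → ℝ) :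
    ∫ t, f (A.symm (t - c)) ∂μ = |LinearMap.det (A : E →ₗ[ℝ] E)| * ∫ t, f t ∂μ := by
  have h := integral_map_equiv (μ := μ) (affineInverse A c).toMeasurableEquiv f
  rw [map_affineInverse, integral_smul_measure, ENNReal.toReal_ofReal (abs_nonneg _)] at h
  exact h.symm

theorem MeasureTheory.Integrable.comp_affineInverse {f : E → ℝ} (hf : Integrable f μ)
    (A : E ≃L[ℝ] E) (c : E) : Integrable (fun t => f (A.symm (t - c))) μ := by
  refine (integrable_map_equiv (affineInverse A c).toMeasurableEquiv f).1 ?_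
  rw [map_affineInverse]
  exact hf.smul_measure ENNReal.ofReal_ne_top

theorem frontier_preimage_affineInverse_null {s : Set E} (hs : μ (frontier s) = 0)
    (A : E ≃L[ℝ] E) (c : E) : μ (frontier ((fun t => A.symm (t - c)) ⁻¹' s)) = 0 := by
  have h : frontier ((fun t => A.symm (t - c)) ⁻¹' s) =
      (affineInverse A c).toMeasurableEquiv ⁻¹' frontier s :=
    ((affineInverse A c).preimage_frontier s).symm
  rw [h, ← MeasurableEquiv.map_apply, map_affineInverse]
  simp [hs]

end AffineChange

variable {m : ℕ}

/-- The substitution `t ↦ -t` absorbs the reflection and leaves a correlation integral, to which the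
window equation applies directly. -/
theorem crossCovariogram_apply (V W : Set (EuclideanSpace ℝ (Fin m)))
    (y : EuclideanSpace ℝ (Fin m)) :
    crossCovariogram V W y =
      ∫ t, V.indicator (fun _ => (1 : ℝ)) t * W.indicator (fun _ => (1 : ℝ)) (t + y) := by
  rw [crossCovariogram, convolution_def, ← integral_neg_eq_self]
  refine integral_congr_ae (Eventually.of_forall fun t => ?_)
  simp only [ContinuousLinearMap.mul_apply', sub_neg_eq_add, add_comm y t]
  congr 1
  exact Set.indicator_one_eq_of_mem_iff (by simp)

namespace IsRegularWindow

variable {V W : Set (EuclideanSpace ℝ (Fin m))}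

theorem measure_ne_top (hW : IsRegularWindow W) : volume W ≠ ⊤ :=
  ((measure_mono subset_closure).trans_lt hW.1.measure_lt_top).ne

theorem measureReal_pos (hW : IsRegularWindow W) : 0 < volume.real W :=
  ENNReal.toReal_pos ((isOpen_interior.measure_pos volume hW.2.1).trans_le
    (measure_mono interior_subset)).ne' hW.measure_ne_top

theorem nullMeasurableSet (hW : IsRegularWindow W) : NullMeasurableSet W volume :=
  nullMeasurableSet_of_null_frontier hW.2.2

theorem integrable_indicator (hW : IsRegularWindow W) :
    Integrable (W.indicator fun _ => (1 : ℝ)) volume :=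
  (integrableOn_const hW.measure_ne_top).integrable_indicator₀ hW.nullMeasurableSet

theorem integral_indicator (hW : IsRegularWindow W) :
    ∫ t, W.indicator (fun _ => (1 : ℝ)) t = volume.real W := by
  rw [integral_indicator₀ hW.nullMeasurableSet]
  simp

theorem integrable_indicator_mul_indicator (hV : IsRegularWindow V) (hW : IsRegularWindow W)
    (d : EuclideanSpace ℝ (Fin m)) :
    Integrable (fun t => V.indicator (fun _ => (1 : ℝ)) t *
      W.indicator (fun _ => (1 : ℝ)) (t + d)) volume := by
  refine hV.integrable_indicator.mul_bdd (c := 1) (hW.integrable_indicator.comp_add_right d).1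
    (Eventually.of_forall fun t => ?_)
  refine (norm_indicator_le_norm_self _ _).trans ?_
  simp

end IsRegularWindow

/-! ### Window equation, volume scaling and renormalisation -/

namespace Inflation.Tiling

variable {n : ℕ} {ϱ : Inflation n} {τ : ϱ.Tiling} {P : EuclideanCPS m}
  {W : Fin n → Set (EuclideanSpace ℝ (Fin m))}
  {A : EuclideanSpace ℝ (Fin m) ≃L[ℝ] EuclideanSpace ℝ (Fin m)}

/-- The inflation equation for the windows. -/
theorem IsFixedPoint.ae_sum_indicator_window_eq (hτ : τ.IsFixedPoint) (hu : ϱ.Unimodular)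
    (hpos : 0 < ϱ.factor) (hW : ∀ i, IsRegularWindow (W i))
    (hZ : HasZeroDensity (τ.defect P W)) (hA : P.IsStarDilation ϱ.factor A) (i : Fin n) :
    ∀ᵐ u, (W i).indicator (fun _ => (1 : ℝ)) u =
      ∑ k, ∑ r ∈ ϱ.displacement i k,
        (W k).indicator (fun _ => (1 : ℝ)) (A.symm (u - P.star r)) := by
  have hL := L_eq_lengthModule (fun i => (hW i).2.1) hZ
  have hinv : ∀ x ∈ P.L, ϱ.factor⁻¹ * x ∈ P.L := fun x hx => by
    rw [hL] at hx ⊢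
    exact ϱ.inv_factor_mul_mem_lengthModule hu hpos.ne' hx
  have hT : ∀ k, ∀ r ∈ ϱ.displacement i k, r ∈ P.L := fun k r hr => by
    rw [hL]
    exact ϱ.displacement_mem_lengthModule hr
  have hfr : ∀ᵐ u : EuclideanSpace ℝ (Fin m), u ∉ frontier (W i) ∧
      ∀ k, ∀ r ∈ ϱ.displacement i k,
        u ∉ frontier ((fun t => A.symm (t - P.star r)) ⁻¹' W k) := by
    refine (measure_eq_zero_iff_ae_notMem.1 (hW i).2.2).and (ae_all_iff.2 fun k => ?_)
    refine (ae_ball_iff (ϱ.displacement i k).countable_toSet).2 fun r _ => ?_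
    exact measure_eq_zero_iff_ae_notMem.1
      (frontier_preimage_affineInverse_null volume (hW k).2.2 A (P.star r))
  filter_upwards [hfr] with u ⟨hui, huk⟩
  -- Off the boundaries all the indicators are locally constant, so a failure at `u` persists on an
  -- open set `U`. Some `x ∈ L` has `x^⋆ ∈ U` while `x` and all candidate predecessors `λ⁻¹(x - r)`
  -- avoid the defect; there the partition of control points yields the identity, a contradiction.
  by_contra hne
  have hnhds : ∀ᶠ v in 𝓝 u, (W i).indicator (fun _ => (1 : ℝ)) v ≠
      ∑ k, ∑ r ∈ ϱ.displacement i k,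
        (W k).indicator (fun _ => (1 : ℝ)) (A.symm (v - P.star r)) := by
    have hall : ∀ᶠ v in 𝓝 u, ∀ k, ∀ r ∈ ϱ.displacement i k,
        (A.symm (v - P.star r) ∈ W k ↔ A.symm (u - P.star r) ∈ W k) :=
      eventually_all.2 fun k => (eventually_all_finset _).2 fun r hr =>
        eventually_mem_iff_of_notMem_frontier (huk k r hr)
    filter_upwards [eventually_mem_iff_of_notMem_frontier hui, hall] with v hvi hvk
    rw [Set.indicator_one_eq_of_mem_iff hvi, Finset.sum_congr rfl fun k _ =>
      Finset.sum_congr rfl fun r hr => Set.indicator_one_eq_of_mem_iff (hvk k r hr)]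
    exact hne
  obtain ⟨U, hUsub, hU, huU⟩ := eventually_nhds_iff.1 hnhds
  have hbad : HasZeroDensity (τ.defect P W ∪ ⋃ k, ⋃ r ∈ ϱ.displacement i k,
      {y | ϱ.factor⁻¹ * y + -(ϱ.factor⁻¹ * r) ∈ τ.defect P W}) :=
    hZ.union (HasZeroDensity.iUnion fun k => HasZeroDensity.biUnion_finset _ fun r _ =>
      hZ.preimage_affine (inv_ne_zero hpos.ne') _)
  obtain ⟨x, ⟨hxL, hxU⟩, hxZ, _⟩ :=
    (P.relativelyDenseAtTop_cutProject hU ⟨u, huU⟩).exists_mem_notMem hbad 0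
  simp only [Set.mem_union, Set.mem_iUnion, not_or, not_exists, Set.mem_ofPred_eq,
    ← sub_eq_add_neg, ← mul_sub] at hxZ
  refine hUsub _ hxU ?_
  have hi : (W i).indicator (fun _ => (1 : ℝ)) (P.star x) =
      (τ.controlPoints i).indicator (fun _ => (1 : ℝ)) x :=
    Set.indicator_one_eq_of_mem_iff
      ((mem_controlPoints_iff_of_notMem_defect hxZ.1 i).trans (and_iff_right hxL)).symm
  rw [hi, ← hτ.sum_indicator_eq hpos i x]
  refine Finset.sum_congr rfl fun k _ => Finset.sum_congr rfl fun r hr =>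
    Set.indicator_one_eq_of_mem_iff ?_
  have hxr := P.sub_mem_L hxL (hT k r hr)
  have hstar : A.symm (P.star x - P.star r) = P.star (ϱ.factor⁻¹ * (x - r)) := by
    rw [A.symm_apply_eq, ← (hA _ (hinv _ hxr)).2, mul_inv_cancel_left₀ hpos.ne',
      P.star_sub hxL (hT k r hr)]
  rw [hstar, mem_controlPoints_iff_of_notMem_defect (hxZ.2 k r hr) k]
  exact and_iff_right (hinv _ hxr)

/-- The star dilation scales volumes by the inverse of the inflation factor. -/
theorem IsFixedPoint.abs_det_starDilation (hτ : τ.IsFixedPoint) (hu : ϱ.Unimodular)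
    (hpos : 0 < ϱ.factor) (hW : ∀ i, IsRegularWindow (W i))
    (hZ : HasZeroDensity (τ.defect P W)) (hA : P.IsStarDilation ϱ.factor A) :
    |LinearMap.det (A : EuclideanSpace ℝ (Fin m) →ₗ[ℝ] EuclideanSpace ℝ (Fin m))| =
      1 / ϱ.factor := by
  set d := |LinearMap.det (A : EuclideanSpace ℝ (Fin m) →ₗ[ℝ] EuclideanSpace ℝ (Fin m))|
  have hvol : ∀ i, volume.real (W i) =
      ∑ k, ((ϱ.displacement i k).card : ℝ) * (d * volume.real (W k)) := by
    intro i
    rw [← (hW i).integral_indicator,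
      integral_congr_ae (hτ.ae_sum_indicator_window_eq hu hpos hW hZ hA i),
      integral_finsetSum _ fun k _ => integrable_finsetSum _ fun r _ =>
        (hW k).integrable_indicator.comp_affineInverse volume A (P.star r)]
    refine Finset.sum_congr rfl fun k _ => ?_
    rw [integral_finsetSum _ fun r _ =>
      (hW k).integrable_indicator.comp_affineInverse volume A (P.star r)]
    simp only [integral_comp_affineInverse, (hW k).integral_indicator, Finset.sum_const,
      nsmul_eq_mul]
    rfl
  -- Pairing the volumes with the left eigenvector turns the matrix equation into the scalar one `w
  -- = |det A| λ w`, with `w > 0`.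
  set w := ∑ i, ϱ.tileLength i * volume.real (W i) with hw
  have hwpos : 0 < w := Finset.sum_pos
    (fun i _ => mul_pos (ϱ.tileLength_pos i) (hW i).measureReal_pos) ⟨τ.letter 0, by simp⟩
  have h : w = d * ϱ.factor * w := by
    calc w = ∑ i, ∑ k, ϱ.tileLength i * ((ϱ.displacement i k).card : ℝ) *
          (d * volume.real (W k)) := by
          refine Finset.sum_congr rfl fun i _ => ?_
          conv_lhs => rw [hvol i]
          rw [Finset.mul_sum]
          exact Finset.sum_congr rfl fun k _ => (mul_assoc _ _ _).symm
      _ = ∑ k, ϱ.factor * ϱ.tileLength k * (d * volume.real (W k)) := by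
          rw [Finset.sum_comm]
          refine Finset.sum_congr rfl fun k _ => ?_
          rw [← Finset.sum_mul, ϱ.sum_card_displacement_mul_tileLength]
      _ = d * ϱ.factor * w := by
          rw [hw, Finset.mul_sum]
          exact Finset.sum_congr rfl fun k _ => by ring
  rw [eq_div_iff hpos.ne']
  exact mul_right_cancel₀ hwpos.ne' (by rw [one_mul, ← h])

theorem IsFixedPoint.crossCovariogram_eq (hτ : τ.IsFixedPoint) (hu : ϱ.Unimodular)
    (hpos : 0 < ϱ.factor) (hW : ∀ i, IsRegularWindow (W i))
    (hZ : HasZeroDensity (τ.defect P W)) (hA : P.IsStarDilation ϱ.factor A) (i j : Fin n)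
    (y : EuclideanSpace ℝ (Fin m)) :
    crossCovariogram (W i) (W j) y =
      (1 / ϱ.factor) * ∑ k, ∑ l, ∑ r ∈ ϱ.displacement i k, ∑ s ∈ ϱ.displacement j l,
        crossCovariogram (W k) (W l) (A.symm (y + P.star r - P.star s)) := by
  let f : Fin n → EuclideanSpace ℝ (Fin m) → ℝ := fun k => (W k).indicator fun _ => 1
  -- In the variable `u = A⁻¹(t - r^⋆)`, the second factor is evaluated at a translate of `u` that
  -- no longer depends on `t`.
  have hshift : ∀ r s (t : EuclideanSpace ℝ (Fin m)), A.symm (t + y - P.star s) =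
      A.symm (t - P.star r) + A.symm (y + P.star r - P.star s) := fun r s t => by
    rw [← map_add]
    congr 1
    abel
  have hterm : ∀ k l r s, Integrable
      (fun t => f k (A.symm (t - P.star r)) * f l (A.symm (t + y - P.star s))) volume ∧
      ∫ t, f k (A.symm (t - P.star r)) * f l (A.symm (t + y - P.star s)) =
        (1 / ϱ.factor) *
          crossCovariogram (W k) (W l) (A.symm (y + P.star r - P.star s)) := by
    intro k l r s
    simp only [hshift r s]
    refine ⟨((hW k).integrable_indicator_mul_indicator (hW l) _).comp_affineInverse
      volume A (P.star r), ?_⟩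
    rw [crossCovariogram_apply, ← hτ.abs_det_starDilation hu hpos hW hZ hA]
    exact integral_comp_affineInverse volume A (P.star r)
      fun u => f k u * f l (u + A.symm (y + P.star r - P.star s))
  have hae : ∀ᵐ t : EuclideanSpace ℝ (Fin m), f i t * f j (t + y) =
      ∑ k, ∑ l, ∑ r ∈ ϱ.displacement i k, ∑ s ∈ ϱ.displacement j l,
        f k (A.symm (t - P.star r)) * f l (A.symm (t + y - P.star s)) := by
    filter_upwards [hτ.ae_sum_indicator_window_eq hu hpos hW hZ hA i,
      (measurePreserving_add_right volume y).quasiMeasurePreserving.ae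
        (hτ.ae_sum_indicator_window_eq hu hpos hW hZ hA j)] with t h1 h2
    simp only [f, h1, h2, Finset.sum_mul_sum]
  rw [crossCovariogram_apply, integral_congr_ae hae, Finset.mul_sum,
    integral_finsetSum _ fun k _ => integrable_finsetSum _ fun l _ =>
      integrable_finsetSum _ fun r _ => integrable_finsetSum _ fun s _ => (hterm k l r s).1]
  refine Finset.sum_congr rfl fun k _ => ?_
  rw [Finset.mul_sum, integral_finsetSum _ fun l _ =>
      integrable_finsetSum _ fun r _ => integrable_finsetSum _ fun s _ => (hterm k l r s).1]
  refine Finset.sum_congr rfl fun l _ => ?_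
  rw [Finset.mul_sum, integral_finsetSum _ fun r _ =>
    integrable_finsetSum _ fun s _ => (hterm k l r s).1]
  refine Finset.sum_congr rfl fun r _ => ?_
  rw [Finset.mul_sum, integral_finsetSum _ fun s _ => (hterm k l r s).1]
  exact Finset.sum_congr rfl fun s _ => (hterm k l r s).2

end Inflation.Tiling

end

end

theorem mainTheorem1 {n m : ℕ} (ϱ : Inflation n)
    (hunimodular : ϱ.Unimodular) (hPV : IsPVNumber ϱ.factor)
    (τ : ϱ.Tiling) (hfixed : τ.IsFixedPoint)
    (P : EuclideanCPS m) (W : Fin n → Set (EuclideanSpace ℝ (Fin m)))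
    (hregular : ∀ i, IsRegularWindow (W i))
    (hmodel : ∀ i, HasZeroDensity (symmDiff (τ.controlPoints i) (P.cutProject (W i)))) :
    (∀ i j, ∀ t ∈ ϱ.displacement i j, t ∈ P.L) ∧
    (∃! A : EuclideanSpace ℝ (Fin m) ≃L[ℝ] EuclideanSpace ℝ (Fin m),
      P.IsStarDilation ϱ.factor A) ∧
    ∀ A : EuclideanSpace ℝ (Fin m) ≃L[ℝ] EuclideanSpace ℝ (Fin m),
      P.IsStarDilation ϱ.factor A →
      ∀ i j, ∀ᵐ y ∂(MeasureTheory.volume : MeasureTheory.Measure (EuclideanSpace ℝ (Fin m))),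
        crossCovariogram (W i) (W j) y =
          (1 / ϱ.factor) * ∑ k, ∑ l, ∑ r ∈ ϱ.displacement i k, ∑ s ∈ ϱ.displacement j l,
            crossCovariogram (W k) (W l) (A.symm (y + P.star r - P.star s)) := by
  have hpos : 0 < ϱ.factor := one_pos.trans hPV.1
  have hZ : HasZeroDensity (τ.defect P W) := HasZeroDensity.iUnion hmodel
  have hint : ∀ i, (interior (W i)).Nonempty := fun i => (hregular i).2.1
  refine ⟨fun i j t ht => ?_, ?_, fun A hA i j =>
    Filter.Eventually.of_forall
      (hfixed.crossCovariogram_eq hunimodular hpos hregular hZ hA i j)⟩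
  · rw [Inflation.Tiling.L_eq_lengthModule hint hZ]
    exact ϱ.displacement_mem_lengthModule ht
  · obtain ⟨A, hA⟩ := Inflation.Tiling.exists_isStarDilation hfixed hunimodular hpos hint
      (fun i => (hregular i).1) hZ
    exact ⟨A, hA, fun A' hA' => EuclideanCPS.IsStarDilation.unique P hA' hA⟩
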